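/- Let $\mathcal S,\mathcal A,\mathcal B$ be nonempty finite sets, $\gamma\in(0,1)$, $\tau_\phi,\tau_\psi>0$, $\mathcal P(\cdot\mid s,a,b)$ a transition kernel on $\mathcal S$, $\rho$ a distribution on $\mathcal S$ with $\rho(s)>0$ for all $s$, and, for each parameter $x$, let $r_x:\mathcal S\times\mathcal A\times\mathcal B\to\mathbb R$ be a reward function. For $\phi\in\mathbb R^{\mathcal S\times\mathcal A}$ and $\psi\in\mathbb R^{\mathcal S\times\mathcal B}$ let $\pi_\phi(a\mid s)=e^{\phi(s,a)}/\sum_{a'}e^{\phi(s,a')}$ and $\pi_\psi(b\mid s)=e^{\psi(s,b)}/\sum_{b'}e^{\psi(s,b')}$ be the tabular softmax policies, and set $$J(x,\phi,\psi)=\mathbb E\Big[\sum_{t=0}^\infty\gamma^t\big(r_x(s_t,a_t,b_t)-\tau_\phi H(\pi_\phi(\cdot\mid s_t))+\tau_\psi H(\pi_\psi(\cdot\mid s_t))\big)\Big],$$ where $H$ is the Shannon entropy (natural logarithm), $s_0\sim\rho$, $a_t\sim\pi_\phi(\cdot\mid s_t)$ and $b_t\sim\pi_\psi(\cdot\mid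 s_t)$ are drawn independently given $s_t$, and $s_{t+1}\sim\mathcal P(\cdot\mid s_t,a_t,b_t)$. Let $$g(x,\phi,\psi)=\max_{\psi'}J(x,\phi,\psi')-\min_{\phi'}J(x,\phi',\psi)$$ be the Nikaido–Isoda function. Then, for every $x$ and every $(\phi,\psi)$, the maximum and the minimum are attained, $g(x,\cdot,\cdot)$ is differentiable at $(\phi,\psi)$, and $$\tfrac12\big\|\nabla_{(\phi,\psi)}g(x,\phi,\psi)\big\|_2^2\ \ge\ \mu(\phi,\psi)\,g(x,\phi,\psi),$$ where $$\mu(\phi,\psi)=(1-\gamma)\,\frac{\min\{\tau_\phi,\tau_\psi\}}{|\mathcal S|}\,\min_s\rho(s)^2\,\min\Big\{\min_{s,a}\pi_\phi(a\mid s)^2,\ \min_{s,b}\pi_\psi(b\mid s)^2\Big\}>0.$$ -/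

import Mathlib

open MeasureTheory ProbabilityTheory

noncomputable section

/-- Shannon entropy (natural logarithm, `0 log 0 = 0`) of a distribution on a finite set. -/
def shannonEntropy {A : Type*} [Fintype A] (p : PMF A) : ℝ :=
  ∑ a, Real.negMulLog (p a).toReal

/-- The softmax distribution with logits `v`. -/
def softmax {A : Type*} [Fintype A] [Nonempty A] (v : A → ℝ) : PMF A :=
  PMF.ofFintype (fun a => ENNReal.ofReal (Real.exp (v a) / ∑ a', Real.exp (v a'))) (by
    have hpos : 0 < ∑ a' : A, Real.exp (v a') :=
      Finset.sum_pos (fun a _ => Real.exp_pos _) Finset.univ_nonempty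
    rw [← ENNReal.ofReal_sum_of_nonneg
      (fun a _ => div_nonneg (Real.exp_pos _).le hpos.le), ← Finset.sum_div,
      div_self hpos.ne', ENNReal.ofReal_one])

/-- Tabular policy parameters: one real logit for every (state, action) pair, with the
Euclidean norm. -/
abbrev PolicyParam (S A : Type*) : Type _ := EuclideanSpace ℝ (S × A)

/-- The tabular softmax policy `π_φ(a | s) = exp φ(s,a) / ∑_{a'} exp φ(s,a')`. -/
def softmaxPolicy {S A : Type*} [Fintype A] [Nonempty A] (φ : PolicyParam S A) (s : S) : PMF A :=
  softmax (fun a => φ (s, a))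

/-- An entropy-regularized two-player zero-sum Markov game with discounted payoff, whose reward
depends on an outer parameter `x : X`. The min-player acts in `A`, the max-player in `B`. -/
structure EntropyMarkovGame (X S A B : Type*) where
  /-- reward `r_x(s, a, b)` -/
  reward : X → S → A → B → ℝ
  /-- transition kernel `P(· | s, a, b)` -/
  trans : S → A → B → PMF S
  /-- initial state distribution -/
  init : PMF S
  /-- discount factor -/
  γ : ℝ
  /-- regularization coefficient of the min-player -/
  τφ : ℝ
  /-- regularization coefficient of the max-player -/
  τψ : ℝ
  init_pos : ∀ s, 0 < init s
  γ_pos : 0 < γ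
  γ_lt_one : γ < 1
  τφ_pos : 0 < τφ
  τψ_pos : 0 < τψ

namespace EntropyMarkovGame

variable {X S A B : Type*}

section Payoff

variable [Fintype A] [Fintype B]

/-- The entropy regularizer `h_s(π(·|s), σ(·|s)) = -τφ H(π(·|s)) + τψ H(σ(·|s))`. -/
def regularizer (M : EntropyMarkovGame X S A B) (p : PMF A) (q : PMF B) : ℝ :=
  -M.τφ * shannonEntropy p + M.τψ * shannonEntropy q

/-- The regularized payoff of one stage, `r_x(s, a, b) + h_s(π(·|s), σ(·|s))`. -/
def stagePayoff (M : EntropyMarkovGame X S A B) (x : X) (π : S → PMF A) (σ : S → PMF B)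
    (z : S × A × B) : ℝ :=
  M.reward x z.1 z.2.1 z.2.2 + M.regularizer (π z.1) (σ z.1)

/-- The discounted regularized payoff of a trajectory. -/
def discountedReturn (M : EntropyMarkovGame X S A B) (x : X) (π : S → PMF A) (σ : S → PMF B)
    (ω : ℕ → S × A × B) : ℝ :=
  ∑' t : ℕ, M.γ ^ t * M.stagePayoff x π σ (ω t)

/-- The series defining the discounted return converges on every trajectory. -/
theorem summable_discountedReturn [Finite S] (M : EntropyMarkovGame X S A B) (x : X) (π : S → PMF A)
    (σ : S → PMF B) (ω : ℕ → S × A × B) :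
    Summable fun t : ℕ => M.γ ^ t * M.stagePayoff x π σ (ω t) := by
  obtain ⟨C, hC⟩ := (Set.finite_range fun z => |M.stagePayoff x π σ z|).bddAbove
  refine Summable.of_norm_bounded
    ((summable_geometric_of_lt_one M.γ_pos.le M.γ_lt_one).mul_right C) fun t => ?_
  rw [Real.norm_eq_abs, abs_mul, abs_of_nonneg (pow_nonneg M.γ_pos.le t)]
  exact mul_le_mul_of_nonneg_left (hC ⟨ω t, rfl⟩) (pow_nonneg M.γ_pos.le t)

end Payoff

/-- The law of `(s, a, b)` when `s ∼ μ` and then, independently given `s`, `a ∼ π(· | s)` and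
`b ∼ σ(· | s)`. -/
def stateActionLaw (μ : PMF S) (π : S → PMF A) (σ : S → PMF B) : PMF (S × A × B) :=
  μ.bind fun s => (π s).bind fun a => (σ s).bind fun b => PMF.pure (s, a, b)

section Trajectory

variable [Fintype S] [Fintype A] [Fintype B]
  [MeasurableSpace S] [MeasurableSingletonClass S]
  [MeasurableSpace A] [MeasurableSingletonClass A]
  [MeasurableSpace B] [MeasurableSingletonClass B]

/-- One step of the play: from `(s, a, b)`, draw `s' ∼ P(· | s, a, b)`, then `a' ∼ π(· | s')` and
`b' ∼ σ(· | s')`. -/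
def stepKernel (M : EntropyMarkovGame X S A B) (π : S → PMF A) (σ : S → PMF B) :
    Kernel (S × A × B) (S × A × B) where
  toFun z := (stateActionLaw (M.trans z.1 z.2.1 z.2.2) π σ).toMeasure
  measurable' := Measurable.of_discrete

instance (M : EntropyMarkovGame X S A B) (π : S → PMF A) (σ : S → PMF B) :
    IsMarkovKernel (M.stepKernel π σ) :=
  ⟨fun z => inferInstanceAs
    (IsProbabilityMeasure (stateActionLaw (M.trans z.1 z.2.1 z.2.2) π σ).toMeasure)⟩

/-- `stepKernel`, read as a kernel from the history up to time `n` (it only uses the last entry). -/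
def historyKernel (M : EntropyMarkovGame X S A B) (π : S → PMF A) (σ : S → PMF B) (n : ℕ) :
    Kernel ((_ : Finset.Iic n) → S × A × B) (S × A × B) :=
  (M.stepKernel π σ).comap (fun h => h ⟨n, Finset.mem_Iic.2 le_rfl⟩) (measurable_pi_apply _)

instance (M : EntropyMarkovGame X S A B) (π : S → PMF A) (σ : S → PMF B) (n : ℕ) :
    IsMarkovKernel (M.historyKernel π σ n) := by
  unfold historyKernel
  infer_instance

/-- The law of the trajectory `(s_t, a_t, b_t)_{t ≥ 0}` under the policies `π, σ`, started from
`s_0 = s`. -/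
def trajectoryLaw (M : EntropyMarkovGame X S A B) (π : S → PMF A) (σ : S → PMF B) (s : S) :
    Measure (ℕ → S × A × B) :=
  Kernel.trajMeasure (X := fun _ => S × A × B)
    (stateActionLaw (PMF.pure s) π σ).toMeasure (M.historyKernel π σ)

instance (M : EntropyMarkovGame X S A B) (π : S → PMF A) (σ : S → PMF B) (s : S) :
    IsProbabilityMeasure (M.trajectoryLaw π σ s) := by
  unfold trajectoryLaw
  infer_instance

/-- The regularized state-value function. -/
def stateValue (M : EntropyMarkovGame X S A B) (x : X) (π : S → PMF A) (σ : S → PMF B)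
    (s : S) : ℝ :=
  ∫ ω, M.discountedReturn x π σ ω ∂(M.trajectoryLaw π σ s)

/-- The value for `s_0 ∼ ρ`. -/
def value (M : EntropyMarkovGame X S A B) (x : X) (π : S → PMF A) (σ : S → PMF B) : ℝ :=
  ∑ s, (M.init s).toReal * M.stateValue x π σ s

/-- The discounted return is integrable, so `stateValue` is a genuine expectation. -/
theorem integrable_discountedReturn (M : EntropyMarkovGame X S A B) (x : X) (π : S → PMF A)
    (σ : S → PMF B) (s : S) :
    Integrable (M.discountedReturn x π σ) (M.trajectoryLaw π σ s) := by
  obtain ⟨C, hC⟩ := (Set.finite_range fun z => |M.stagePayoff x π σ z|).bddAbove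
  have hg := (summable_geometric_of_lt_one M.γ_pos.le M.γ_lt_one).mul_right C
  refine Integrable.of_bound (C := ∑' t : ℕ, M.γ ^ t * C) ?_ (Filter.Eventually.of_forall fun ω => ?_)
  · have hm : ∀ t : ℕ, Measurable fun ω : ℕ → S × A × B =>
        M.γ ^ t * M.stagePayoff x π σ (ω t) := fun t =>
      ((Measurable.of_discrete (f := M.stagePayoff x π σ)).comp (measurable_pi_apply t)).const_mul _
    exact (measurable_of_tendsto_metrizable
      (f := fun n (ω : ℕ → S × A × B) =>
        ∑ t ∈ Finset.range n, M.γ ^ t * M.stagePayoff x π σ (ω t))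
      (fun n => Finset.measurable_sum _ fun t _ => hm t)
      (tendsto_pi_nhds.2 fun ω =>
        (M.summable_discountedReturn x π σ ω).hasSum.tendsto_sum_nat)).aestronglyMeasurable
  · refine tsum_of_norm_bounded hg.hasSum fun t => ?_
    rw [Real.norm_eq_abs, abs_mul, abs_of_nonneg (pow_nonneg M.γ_pos.le t)]
    exact mul_le_mul_of_nonneg_left (hC ⟨ω t, rfl⟩) (pow_nonneg M.γ_pos.le t)

variable [Nonempty A] [Nonempty B]

/-- The objective `J(x, φ, ψ)` of the game under softmax policies. -/
def J (M : EntropyMarkovGame X S A B) (x : X) (φ : PolicyParam S A) (ψ : PolicyParam S B) : ℝ :=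
  M.value x (softmaxPolicy φ) (softmaxPolicy ψ)

/-- The Nikaido–Isoda function `g(x, φ, ψ) = max_{ψ'} J(x, φ, ψ') - min_{φ'} J(x, φ', ψ)`. -/
def niGap (M : EntropyMarkovGame X S A B) (x : X) (φ : PolicyParam S A) (ψ : PolicyParam S B) : ℝ :=
  (⨆ ψ' : PolicyParam S B, M.J x φ ψ') - ⨅ φ' : PolicyParam S A, M.J x φ' ψ

/-- The Nikaido–Isoda function as a function of the concatenated parameter `(φ, ψ)`, which lives in
the Euclidean product space. -/
def niGapJoint (M : EntropyMarkovGame X S A B) (x : X)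
    (θ : WithLp 2 (PolicyParam S A × PolicyParam S B)) : ℝ :=
  M.niGap x θ.fst θ.snd

end Trajectory

/-- The constant
`μ(φ,ψ) = (1-γ) (min{τφ,τψ} / |S|) min_s ρ(s)² min{min_{s,a} π_φ(a|s)², min_{s,b} π_ψ(b|s)²}`. -/
def plConstant [Fintype S] [Fintype A] [Fintype B] [Nonempty A] [Nonempty B]
    (M : EntropyMarkovGame X S A B) (φ : PolicyParam S A) (ψ : PolicyParam S B) : ℝ :=
  (1 - M.γ) * (min M.τφ M.τψ / Fintype.card S) * (⨅ s, (M.init s).toReal ^ 2) *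
    min (⨅ p : S × A, (softmaxPolicy φ p.1 p.2).toReal ^ 2)
      (⨅ p : S × B, (softmaxPolicy ψ p.1 p.2).toReal ^ 2)

end EntropyMarkovGame

end

/-!
For a fixed opponent, the game is an entropy-regularized Markov decision process for the remaining
player: its value under softmax logits `v` solves the Bellman equation
`U = softAverage τ v (actionValue c P γ U)` (`EntropyMarkovGame.stateValue_eq`,
`sum_sum_eq_softAverage`), and the optimal value solves `V = softMaximum τ (actionValue c P γ V)`.
Both right-hand sides are `γ`-contractions in the continuation value. A comparison principle
(`le_add_of_le_actionValue`) gives `U ≤ V`, with equality for the logits `q* / τ`, so best responses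
exist; the implicit function theorem (`differentiableAt_of_fixedPoint_contraction`) makes `U`
differentiable in the logits and `V` differentiable in the parameters of the opponent.

The Polyak–Łojasiewicz inequality for one player (`mul_optimalValue_sub_le_norm_gradient_sq`)
combines two estimates. The one-step suboptimality `softMaximum - softAverage` is
`τ log ∑ σ exp (A / τ)` for the advantage `A`, which is centred under the policy `σ`, so Hoeffding's
bound makes it at most `∑ A² / (2 τ)`; the comparison principle turns this into a bound for `V - U`
at the price of a factor `1 / (1 - γ)`. Differentiating the Bellman equation shows that the
partial derivative in the logit `(s, b)` is at least `ρ(s) σ(b | s) |A(s, b)|` in absolute value.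
No factor `1 / |S|` is lost, since the supremum over states is bounded by a sum.

The gap is `F φ + F' ψ`, where `F` and `F'` are the best-response values of the max-player (payoff
`J`) and of the min-player (payoff `-J`). If `ψ₁` is a best response to `φ`, then `F ≥ J(·, ψ₁)`
with equality at `φ`, so `∇F(φ) = ∇_φ J(φ, ψ₁)` has the lower bound in terms of
`F φ + F' ψ₁ = J(φ, ψ₁) - min J(·, ψ₁)`; symmetrically `∇F'(ψ)` in terms of `F φ₁ + F' ψ`. The sum
of the two gaps is `(F φ + F' ψ) + (F φ₁ + F' ψ₁)`, and the last term is nonnegative by weak duality.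
-/

noncomputable section

/-! ### The Bellman equation for the value of a pair of policies -/

namespace EntropyMarkovGame

variable {X S A B : Type*}

section Bellman

variable [Fintype S] [Fintype A] [Fintype B]

/-- The average of `f (s, a, b)` over independent actions `a ∼ π(· | s)`, `b ∼ σ(· | s)`. -/
def actionAverage (π : S → PMF A) (σ : S → PMF B) (f : S × A × B → ℝ) (s : S) : ℝ :=
  ∑ a, ∑ b, (π s a).toReal * (σ s b).toReal * f (s, a, b)

theorem stateActionLaw_apply (μ : PMF S) (π : S → PMF A) (σ : S → PMF B) (z : S × A × B) :
    stateActionLaw μ π σ z = μ z.1 * (π z.1 z.2.1 * σ z.1 z.2.2) := by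
  classical
  obtain ⟨s, a, b⟩ := z
  simp only [stateActionLaw, PMF.bind_apply, PMF.pure_apply, tsum_fintype, Prod.mk.injEq]
  rw [Finset.sum_eq_single s, Finset.sum_eq_single a, Finset.sum_eq_single b]
  · simp
  · intro b' _ hb; simp [hb.symm]
  · simp
  · intro a' _ ha; simp [ha.symm]
  · simp
  · intro s' _ hs; simp [hs.symm]
  · simp

variable [MeasurableSpace S] [MeasurableSingletonClass S]
  [MeasurableSpace A] [MeasurableSingletonClass A]
  [MeasurableSpace B] [MeasurableSingletonClass B]

theorem integral_stateActionLaw (μ : PMF S) (π : S → PMF A) (σ : S → PMF B)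
    (f : S × A × B → ℝ) :
    ∫ z, f z ∂(stateActionLaw μ π σ).toMeasure
      = ∑ s, (μ s).toReal * actionAverage π σ f s := by
  rw [PMF.integral_eq_sum]
  simp only [stateActionLaw_apply, Fintype.sum_prod_type, actionAverage, Finset.mul_sum,
    ENNReal.toReal_mul, smul_eq_mul, mul_assoc]

/-- The expected value of `f` one step after `(s, a, b)`. -/
def nextAverage (M : EntropyMarkovGame X S A B) (π : S → PMF A) (σ : S → PMF B)
    (f : S × A × B → ℝ) (z : S × A × B) : ℝ :=
  ∑ s', (M.trans z.1 z.2.1 z.2.2 s').toReal * actionAverage π σ f s'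

/-- The Markov property: the law of the trajectory at time `t + 1` is obtained from the law at
time `t` by one step of the play. -/
theorem integral_eval_succ (M : EntropyMarkovGame X S A B) (π : S → PMF A) (σ : S → PMF B)
    (s : S) (f : S × A × B → ℝ) (t : ℕ) :
    ∫ ω, f (ω (t + 1)) ∂M.trajectoryLaw π σ s
      = ∫ ω, M.nextAverage π σ f (ω t) ∂M.trajectoryLaw π σ s := by
  have hf : Measurable f := Measurable.of_discrete
  obtain ⟨C, hC⟩ := (Set.finite_range fun z => ‖f z‖).bddAbove
  have key := Kernel.map_frestrictLe_trajMeasure_compProd_eq_map_trajMeasure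
    (X := fun _ => S × A × B) (μ₀ := (stateActionLaw (PMF.pure s) π σ).toMeasure)
    (κ := M.historyKernel π σ) (a := t)
  rw [trajectoryLaw]
  set T := Kernel.trajMeasure (X := fun _ => S × A × B)
    (stateActionLaw (PMF.pure s) π σ).toMeasure (M.historyKernel π σ) with hT
  have hmeas : Measurable fun ω : ℕ → S × A × B => (Preorder.frestrictLe (π := fun _ => S × A × B) t ω, ω (t + 1)) := by
    fun_prop
  have h1 : ∫ ω, f (ω (t + 1)) ∂T
      = ∫ p, f p.2 ∂(T.map fun ω => (Preorder.frestrictLe (π := fun _ => S × A × B) t ω, ω (t + 1))) := by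
    rw [integral_map hmeas.aemeasurable]
    exact (hf.comp measurable_snd).aestronglyMeasurable
  have : IsProbabilityMeasure (T.map (Preorder.frestrictLe (π := fun _ => S × A × B) t)) :=
    Measure.isProbabilityMeasure_map (by fun_prop)
  rw [h1, ← key, Measure.integral_compProd, integral_map]
  · refine integral_congr_ae (Filter.Eventually.of_forall fun ω => ?_)
    exact integral_stateActionLaw _ π σ f
  · fun_prop
  · exact (StronglyMeasurable.integral_kernel_prod_right'
      (κ := M.historyKernel π σ t) (f := fun p => f p.2)
      (hf.comp measurable_snd).stronglyMeasurable).aestronglyMeasurable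
  · exact Integrable.of_bound (C := C) (hf.comp measurable_snd).aestronglyMeasurable
      (Filter.Eventually.of_forall fun p => hC ⟨p.2, rfl⟩)

theorem integral_eval_zero (M : EntropyMarkovGame X S A B) (π : S → PMF A) (σ : S → PMF B)
    (s : S) (f : S × A × B → ℝ) :
    ∫ ω, f (ω 0) ∂M.trajectoryLaw π σ s = actionAverage π σ f s := by
  have hf : Measurable f := Measurable.of_discrete
  have key : (M.trajectoryLaw π σ s).map (Preorder.frestrictLe (π := fun _ => S × A × B) 0)
      = (stateActionLaw (PMF.pure s) π σ).toMeasure.map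
        (MeasurableEquiv.piUnique fun _ : Finset.Iic 0 => S × A × B).symm := by
    rw [trajectoryLaw, Kernel.trajMeasure, Measure.map_comp _ _ (by fun_prop),
      Kernel.traj_map_frestrictLe, Kernel.partialTraj_self, Measure.id_comp]
  have hg : AEStronglyMeasurable (fun h : (_ : Finset.Iic 0) → S × A × B =>
      f (h ⟨0, Finset.mem_Iic.2 le_rfl⟩)) ((M.trajectoryLaw π σ s).map
        (Preorder.frestrictLe (π := fun _ => S × A × B) 0)) :=
    (hf.comp (measurable_pi_apply _)).aestronglyMeasurable
  calc ∫ ω, f (ω 0) ∂M.trajectoryLaw π σ s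
      = ∫ h : (_ : Finset.Iic 0) → S × A × B, f (h ⟨0, Finset.mem_Iic.2 le_rfl⟩)
          ∂(M.trajectoryLaw π σ s).map (Preorder.frestrictLe (π := fun _ => S × A × B) 0) :=
        (integral_map (by fun_prop) hg).symm
    _ = ∫ z, f z ∂(stateActionLaw (PMF.pure s) π σ).toMeasure := by
        rw [key] at hg ⊢
        rw [integral_map (by fun_prop) hg]
        rfl
    _ = actionAverage π σ f s := by
        classical
        rw [integral_stateActionLaw, Finset.sum_eq_single s] <;> simp +contextual [PMF.pure_apply]

/-- The Markov property at the initial time: the expectation at time `t + 1` averages, over the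
first step, the expectations at time `t` from the next state. -/
theorem integral_eval_succ_eq_actionAverage (M : EntropyMarkovGame X S A B) (π : S → PMF A) (σ : S → PMF B)
    (f : S × A × B → ℝ) (t : ℕ) (s : S) :
    ∫ ω, f (ω (t + 1)) ∂M.trajectoryLaw π σ s
      = actionAverage π σ (fun z => ∑ s', (M.trans z.1 z.2.1 z.2.2 s').toReal *
          ∫ ω, f (ω t) ∂M.trajectoryLaw π σ s') s := by
  induction t generalizing f with
  | zero =>
    rw [integral_eval_succ, integral_eval_zero]
    simp only [integral_eval_zero]
    rfl
  | succ t ih =>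
    rw [integral_eval_succ, ih]
    simp only [integral_eval_succ]

theorem hasSum_stateValue (M : EntropyMarkovGame X S A B) (x : X) (π : S → PMF A)
    (σ : S → PMF B) (s : S) :
    HasSum (fun t : ℕ => M.γ ^ t * ∫ ω, M.stagePayoff x π σ (ω t) ∂M.trajectoryLaw π σ s)
      (M.stateValue x π σ s) := by
  obtain ⟨C, hC⟩ := (Set.finite_range fun z => ‖M.stagePayoff x π σ z‖).bddAbove
  have hm : ∀ t : ℕ, Measurable fun ω : ℕ → S × A × B => M.stagePayoff x π σ (ω t) := fun t =>
    (Measurable.of_discrete (f := M.stagePayoff x π σ)).comp (measurable_pi_apply t)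
  have hb : ∀ (t : ℕ) (ω : ℕ → S × A × B),
      ‖M.γ ^ t * M.stagePayoff x π σ (ω t)‖ ≤ M.γ ^ t * C := fun t ω => by
    rw [norm_mul, Real.norm_of_nonneg (pow_nonneg M.γ_pos.le t)]
    exact mul_le_mul_of_nonneg_left (hC ⟨ω t, rfl⟩) (pow_nonneg M.γ_pos.le t)
  have hg := (summable_geometric_of_lt_one M.γ_pos.le M.γ_lt_one).mul_right C
  simp only [← integral_const_mul]
  refine hasSum_integral_of_dominated_convergence (fun t _ => M.γ ^ t * C)
    (fun t => ((hm t).const_mul _).aestronglyMeasurable)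
    (fun t => Filter.Eventually.of_forall (hb t)) (Filter.Eventually.of_forall fun _ => hg)
    (integrable_const _) (Filter.Eventually.of_forall fun ω =>
      (M.summable_discountedReturn x π σ ω).hasSum)

/-- The Bellman equation for the value of a fixed pair of policies. -/
theorem stateValue_eq (M : EntropyMarkovGame X S A B) (x : X) (π : S → PMF A)
    (σ : S → PMF B) (s : S) :
    M.stateValue x π σ s = actionAverage π σ (fun z => M.stagePayoff x π σ z +
      M.γ * ∑ s', (M.trans z.1 z.2.1 z.2.2 s').toReal * M.stateValue x π σ s') s := by
  have h0 := (hasSum_nat_add_iff' 1).2 (M.hasSum_stateValue x π σ s)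
  simp only [Finset.range_one, Finset.sum_singleton, pow_zero, one_mul, integral_eval_zero,
    integral_eval_succ_eq_actionAverage] at h0
  have h1 : HasSum (fun t : ℕ => M.γ ^ (t + 1) * actionAverage π σ (fun z =>
      ∑ s', (M.trans z.1 z.2.1 z.2.2 s').toReal *
        ∫ ω, M.stagePayoff x π σ (ω t) ∂M.trajectoryLaw π σ s') s)
      (actionAverage π σ (fun z =>
        M.γ * ∑ s', (M.trans z.1 z.2.1 z.2.2 s').toReal * M.stateValue x π σ s') s) := by
    have := hasSum_sum (s := Finset.univ) fun a _ => hasSum_sum (s := Finset.univ) fun b _ =>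
      HasSum.mul_left ((π s a).toReal * (σ s b).toReal) <| HasSum.mul_left M.γ <|
      hasSum_sum (s := Finset.univ) fun s' _ =>
        HasSum.mul_left (M.trans s a b s').toReal (M.hasSum_stateValue x π σ s')
    refine HasSum.congr_fun this fun t => ?_
    simp only [actionAverage, Finset.mul_sum]
    refine Finset.sum_congr rfl fun a _ => Finset.sum_congr rfl fun b _ =>
      Finset.sum_congr rfl fun s' _ => ?_
    ring
  have h2 := h0.unique h1
  rw [sub_eq_iff_eq_add] at h2
  rw [h2]
  simp only [actionAverage, mul_add, Finset.sum_add_distrib]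
  ring

end Bellman

end EntropyMarkovGame

/-! ### Parametrized contractions -/

/-- The fixed point of a parametrized contraction depends differentiably on the parameter. -/
theorem differentiableAt_of_fixedPoint_contraction {E F : Type*} [NormedAddCommGroup E]
    [NormedSpace ℝ E] [CompleteSpace E] [NormedAddCommGroup F] [NormedSpace ℝ F] [CompleteSpace F]
    {G : E × F → F} (hG : ContDiff ℝ 1 G) {K : NNReal} (hK : K < 1)
    (hlip : ∀ e, LipschitzWith K fun v => G (e, v)) {f : E → F} (hf : ∀ e, G (e, f e) = f e)
    (e : E) : DifferentiableAt ℝ f e := by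
  have hGs := hG.contDiffAt.hasStrictFDerivAt (x := (e, f e)) one_ne_zero
  set G' := fderiv ℝ G (e, f e)
  have hH : HasStrictFDerivAt (fun p : E × F => p.2 - G p)
      (ContinuousLinearMap.snd ℝ E F - G') (e, f e) := hasStrictFDerivAt_snd.sub hGs
  have hpart : HasFDerivAt (fun v => G (e, v)) (G' ∘L .inr ℝ E F) (f e) :=
    hGs.hasFDerivAt.comp (f e) (hasFDerivAt_prodMk_right e (f e))
  have hnorm : ‖G' ∘L .inr ℝ E F‖ < 1 := (hpart.le_of_lipschitz (hlip e)).trans_lt hK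
  have hinv : ((ContinuousLinearMap.snd ℝ E F - G') ∘L .inr ℝ E F).IsInvertible := by
    have : (ContinuousLinearMap.snd ℝ E F - G') ∘L .inr ℝ E F = 1 - G' ∘L .inr ℝ E F := by
      ext v; simp
    rw [this]
    obtain ⟨u, hu⟩ := isUnit_one_sub_of_norm_lt_one hnorm
    exact ⟨ContinuousLinearEquiv.unitsEquiv ℝ F u, hu⟩
  have hev := hH.eventually_apply_implicitFunctionOfProdDomain hinv
  refine (hH.hasStrictFDerivAt_implicitFunctionOfProdDomain hinv).hasFDerivAt.differentiableAt
    |>.congr_of_eventuallyEq ?_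
  filter_upwards [hev] with e' he'
  have hfix : Function.IsFixedPt (fun v => G (e', v))
      (hH.implicitFunctionOfProdDomain hinv e') := by
    have : hH.implicitFunctionOfProdDomain hinv e' -
      G (e', hH.implicitFunctionOfProdDomain hinv e') = 0 := by simpa [hf e] using he'
    exact (sub_eq_zero.1 this).symm
  exact ContractingWith.fixedPoint_unique' ⟨hK, hlip e'⟩ (hf e') hfix

/-! ### Regularized dynamic programming operators -/

section DynamicProgramming

variable {S B : Type*} [Fintype S]

/-- `f` is monotone, and raising all its arguments by `k` raises it by at most `k`. -/
def IsSubtranslative (f : (B → ℝ) → ℝ) : Prop :=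
  ∀ (q q' : B → ℝ) (k : ℝ), (∀ b, q b ≤ q' b + k) → f q ≤ f q' + k

/-- The action values for the reward `c`, the transition matrix `P`, and the continuation
value `V`. -/
def actionValue (c : S → B → ℝ) (P : S → B → S → ℝ) (γ : ℝ) (V : S → ℝ) (s : S) (b : B) : ℝ :=
  c s b + γ * ∑ s', P s b s' * V s'

theorem actionValue_le_add {c : S → B → ℝ} {P : S → B → S → ℝ} {γ : ℝ}
    (hP : ∀ s b, P s b ∈ stdSimplex ℝ S) (hγ : 0 ≤ γ) {V W : S → ℝ} {k : ℝ}
    (h : ∀ s, V s ≤ W s + k) (s : S) (b : B) :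
    actionValue c P γ V s b ≤ actionValue c P γ W s b + γ * k := by
  have : ∑ s', P s b s' * V s' ≤ (∑ s', P s b s' * W s') + k :=
    calc ∑ s', P s b s' * V s' ≤ ∑ s', P s b s' * (W s' + k) :=
          Finset.sum_le_sum fun s' _ => mul_le_mul_of_nonneg_left (h s') ((hP s b).1 s')
      _ = _ := by simp only [mul_add, Finset.sum_add_distrib, ← Finset.sum_mul, (hP s b).2, one_mul]
  have := mul_le_mul_of_nonneg_left this hγ
  unfold actionValue
  linarith

/-- Comparison principle: a subsolution `V` of a discounted dynamic programming equation exceeds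
an `ε`-supersolution `W` by at most `ε / (1 - γ)`. -/
theorem le_add_of_le_actionValue {f : S → (B → ℝ) → ℝ} (hf : ∀ s, IsSubtranslative (f s))
    {c : S → B → ℝ} {P : S → B → S → ℝ} {γ : ℝ} (hP : ∀ s b, P s b ∈ stdSimplex ℝ S)
    (hγ : 0 ≤ γ) (hγ1 : γ < 1) {V W : S → ℝ} {ε : ℝ}
    (hV : ∀ s, V s ≤ f s (actionValue c P γ V s))
    (hW : ∀ s, f s (actionValue c P γ W s) ≤ W s + ε) (s : S) :
    V s ≤ W s + ε / (1 - γ) := by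
  have : Nonempty S := ⟨s⟩
  -- at a maximizer of `V - W`, with maximal value `k`, the two hypotheses give `k ≤ γ k + ε`
  obtain ⟨m, hm⟩ := Finite.exists_max fun s => V s - W s
  set k := V m - W m with hk
  have h1 := hf m _ _ _ (actionValue_le_add (c := c) hP hγ (V := V) (W := W) (k := k)
    (fun s => by linarith [hm s]) m)
  have h2 : k ≤ ε / (1 - γ) := by
    rw [le_div_iff₀ (by linarith)]
    linarith [hV m, hW m]
  linarith [hm s]

theorem lipschitzWith_actionValue {f : S → (B → ℝ) → ℝ} (hf : ∀ s, IsSubtranslative (f s))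
    {c : S → B → ℝ} {P : S → B → S → ℝ} {γ : NNReal} (hP : ∀ s b, P s b ∈ stdSimplex ℝ S) :
    LipschitzWith γ fun (V : S → ℝ) s => f s (actionValue c P γ V s) := by
  refine LipschitzWith.of_dist_le_mul fun V W => (dist_pi_le_iff (by positivity)).2 fun s => ?_
  have h : ∀ V W : S → ℝ, ∀ s, V s ≤ W s + dist V W := fun V W s => by
    have := (Real.dist_eq _ _ ▸ dist_le_pi_dist V W s : |V s - W s| ≤ dist V W)
    linarith [le_abs_self (V s - W s)]
  have h1 := hf s _ _ _ (actionValue_le_add (c := c) hP γ.2 (h V W) s)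
  have h2 := hf s _ _ _ (actionValue_le_add (c := c) hP γ.2 (h W V) s)
  rw [dist_comm W V] at h2
  rw [Real.dist_eq, abs_le]
  constructor <;> simp only [NNReal.val_eq_coe] at h1 h2 <;> linarith

/-- A source of size `l` at the single state `s₀`, propagated by a discounted Markov chain, produces
a response `D` of the sign of `l` at every state, of size at least `|l|` at `s₀`; this bounds its
`ρ`-weighted total from below. -/
theorem abs_le_abs_sum_of_source [Fintype B] [DecidableEq S] {P : S → B → S → ℝ} {γ : ℝ}
    (hP : ∀ s b, P s b ∈ stdSimplex ℝ S) (hγ : 0 ≤ γ) (hγ1 : γ < 1) {p : S → B → ℝ}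
    (hp : ∀ s, p s ∈ stdSimplex ℝ B) {s₀ : S} {l : ℝ} {D : S → ℝ}
    (hD : ∀ s, D s = (if s = s₀ then l else 0) + γ * ∑ b, p s b * ∑ s', P s b s' * D s')
    {ρ : S → ℝ} (hρ : ∀ s, 0 ≤ ρ s) :
    ρ s₀ * |l| ≤ |∑ s, ρ s * D s| := by
  -- by linearity, the source may be taken to be nonnegative
  wlog hl : 0 ≤ l generalizing l D
  · have := this (l := -l) (D := -D) (fun s => by
      rw [Pi.neg_apply, hD s]
      simp only [Pi.neg_apply, mul_neg, Finset.sum_neg_distrib]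
      split_ifs <;> ring) (by linarith)
    simpa using this
  have havg : ∀ s, IsSubtranslative fun q => ∑ b, p s b * q b := fun s q q' k h =>
    calc ∑ b, p s b * q b ≤ ∑ b, p s b * (q' b + k) :=
          Finset.sum_le_sum fun b _ => mul_le_mul_of_nonneg_left (h b) ((hp s).1 b)
      _ = _ := by simp only [mul_add, Finset.sum_add_distrib, ← Finset.sum_mul, (hp s).2, one_mul]
  have hD0 : ∀ s, 0 ≤ D s := fun s => by
    have := le_add_of_le_actionValue havg hP hγ hγ1 (c := fun s _ => if s = s₀ then l else 0)
      (V := 0) (W := D) (ε := 0) ?_ ?_ s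
    · simpa using this
    · intro s
      simp only [actionValue, Pi.zero_apply, mul_zero, Finset.sum_const_zero, add_zero,
        ← Finset.sum_mul, (hp s).2, one_mul]
      split_ifs
      exacts [hl, le_rfl]
    · intro s
      refine le_of_eq ?_
      rw [add_zero, hD s]
      simp only [actionValue, mul_add, Finset.sum_add_distrib, ← Finset.sum_mul, (hp s).2, one_mul,
        Finset.mul_sum]
      simp only [mul_left_comm]
  have hl0 : l ≤ D s₀ := by
    rw [hD s₀, if_pos rfl, le_add_iff_nonneg_right]
    exact mul_nonneg hγ <| Finset.sum_nonneg fun b _ => mul_nonneg ((hp s₀).1 b) <|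
      Finset.sum_nonneg fun s' _ => mul_nonneg ((hP s₀ b).1 s') (hD0 s')
  rw [abs_of_nonneg hl]
  calc ρ s₀ * l ≤ ρ s₀ * D s₀ := mul_le_mul_of_nonneg_left hl0 (hρ s₀)
    _ ≤ ∑ s, ρ s * D s := Finset.single_le_sum (f := fun s => ρ s * D s)
        (fun s _ => mul_nonneg (hρ s) (hD0 s)) (Finset.mem_univ s₀)
    _ ≤ _ := le_abs_self _

end DynamicProgramming

/-! ### Entropy-regularized maximization over the simplex -/

section Softmax

variable {B : Type*} [Fintype B]

/-- The softmax probabilities with logits `v`, as real numbers. -/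
def softmaxProb (v : B → ℝ) (b : B) : ℝ :=
  Real.exp (v b) / ∑ b', Real.exp (v b')

/-- `log ∑ exp v`. -/
def logSumExp (v : B → ℝ) : ℝ :=
  Real.log (∑ b, Real.exp (v b))

/-- The `τ`-regularized average `∑ σ q + τ H(σ)` of `q`, where `σ` is the softmax distribution with
logits `v`; the entropy is expanded by `log σ = v - logSumExp v`. -/
def softAverage (τ : ℝ) (v q : B → ℝ) : ℝ :=
  ∑ b, softmaxProb v b * (q b - τ * v b) + τ * logSumExp v

/-- The maximum of `∑ σ q + τ H(σ)` over all distributions `σ`. -/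
def softMaximum (τ : ℝ) (q : B → ℝ) : ℝ :=
  τ * logSumExp fun b => q b / τ

/-- The regularized advantage `q - τ log σ - softAverage τ v q` of the actions over the softmax
distribution `σ` with logits `v`. -/
def softAdvantage (τ : ℝ) (v q : B → ℝ) (b : B) : ℝ :=
  q b - τ * v b - ∑ b', softmaxProb v b' * (q b' - τ * v b')

theorem softAverage_div_eq_softMaximum {τ : ℝ} (hτ : 0 < τ) (q : B → ℝ) :
    softAverage τ (fun b => q b / τ) q = softMaximum τ q := by
  have : ∀ b, q b - τ * (q b / τ) = 0 := fun b => by field_simp; ring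
  simp [softAverage, softMaximum, this]

/-- Hoeffding's bound: the exponential moment of a centred variable with values in `[-m, m]`. -/
theorem sum_mul_exp_le {p X : B → ℝ} (hp : p ∈ stdSimplex ℝ B) {m : ℝ} (hm : 0 < m)
    (hX : ∀ b, |X b| ≤ m) (h0 : ∑ b, p b * X b = 0) :
    ∑ b, p b * Real.exp (X b) ≤ Real.exp (m ^ 2 / 2) := by
  -- the chord of `exp` over `[-m, m]`
  have hchord : ∀ b, Real.exp (X b) ≤ Real.cosh m + X b * (Real.sinh m / m) := fun b => by
    obtain ⟨h1, h2⟩ := abs_le.1 (hX b)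
    have := convexOn_exp.2 (Set.mem_univ (-m)) (Set.mem_univ m)
      (show 0 ≤ (m - X b) / (2 * m) from div_nonneg (by linarith) (by linarith))
      (show 0 ≤ (m + X b) / (2 * m) from div_nonneg (by linarith) (by linarith))
      (by field_simp; ring)
    simp only [smul_eq_mul] at this
    calc Real.exp (X b) = Real.exp ((m - X b) / (2 * m) * -m + (m + X b) / (2 * m) * m) := by
          congr 1; field_simp; ring
      _ ≤ _ := this
      _ = _ := by rw [Real.cosh_eq, Real.sinh_eq]; field_simp; ring
  calc ∑ b, p b * Real.exp (X b)
      ≤ ∑ b, p b * (Real.cosh m + X b * (Real.sinh m / m)) :=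
        Finset.sum_le_sum fun b _ => mul_le_mul_of_nonneg_left (hchord b) (hp.1 b)
    _ = Real.cosh m := by
        simp only [mul_add, Finset.sum_add_distrib, ← Finset.sum_mul, hp.2, ← mul_assoc, h0]
        ring
    _ ≤ _ := Real.cosh_le_exp_half_sq m

variable [Nonempty B]

theorem sum_exp_pos (v : B → ℝ) : 0 < ∑ b, Real.exp (v b) :=
  Finset.sum_pos (fun _ _ => Real.exp_pos _) Finset.univ_nonempty

theorem softmaxProb_pos (v : B → ℝ) (b : B) : 0 < softmaxProb v b :=
  div_pos (Real.exp_pos _) (sum_exp_pos v)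

theorem softmaxProb_mem_stdSimplex (v : B → ℝ) : softmaxProb v ∈ stdSimplex ℝ B :=
  ⟨fun b => (softmaxProb_pos v b).le, by
    simp only [softmaxProb, ← Finset.sum_div, div_self (sum_exp_pos v).ne']⟩

theorem log_softmaxProb (v : B → ℝ) (b : B) :
    Real.log (softmaxProb v b) = v b - logSumExp v := by
  rw [softmaxProb, Real.log_div (Real.exp_pos _).ne' (sum_exp_pos v).ne', Real.log_exp, logSumExp]

theorem isSubtranslative_softAverage (τ : ℝ) (v : B → ℝ) :
    IsSubtranslative (softAverage τ v) := fun q q' k h => by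
  have hp := softmaxProb_mem_stdSimplex v
  have : ∑ b, softmaxProb v b * (q b - τ * v b)
      ≤ ∑ b, softmaxProb v b * (q' b - τ * v b) + k :=
    calc _ ≤ ∑ b, softmaxProb v b * ((q' b - τ * v b) + k) :=
          Finset.sum_le_sum fun b _ => mul_le_mul_of_nonneg_left (by linarith [h b]) (hp.1 b)
      _ = _ := by
          simp only [mul_add _ _ k, Finset.sum_add_distrib, ← Finset.sum_mul, hp.2, one_mul]
  unfold softAverage
  linarith

theorem isSubtranslative_softMaximum {τ : ℝ} (hτ : 0 < τ) :
    IsSubtranslative (softMaximum τ : (B → ℝ) → ℝ) := fun q q' k h => by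
  have : logSumExp (fun b => q b / τ) ≤ logSumExp (fun b => q' b / τ) + k / τ := by
    rw [logSumExp, logSumExp, ← Real.log_exp (k / τ),
      ← Real.log_mul (sum_exp_pos _).ne' (Real.exp_pos _).ne']
    refine Real.log_le_log (sum_exp_pos _) ?_
    rw [Finset.sum_mul]
    refine Finset.sum_le_sum fun b _ => ?_
    rw [← Real.exp_add, ← add_div]
    exact Real.exp_le_exp.2 (div_le_div_of_nonneg_right (h b) hτ.le)
  unfold softMaximum
  calc _ ≤ τ * (logSumExp (fun b => q' b / τ) + k / τ) := mul_le_mul_of_nonneg_left this hτ.le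
    _ = _ := by field_simp

theorem sum_softmaxProb_mul_softAdvantage (τ : ℝ) (v q : B → ℝ) :
    ∑ b, softmaxProb v b * softAdvantage τ v q b = 0 := by
  simp only [softAdvantage, mul_sub _ _ (∑ b', _), Finset.sum_sub_distrib, ← Finset.sum_mul,
    (softmaxProb_mem_stdSimplex v).2, one_mul, sub_self]

/-- The suboptimality of a softmax distribution is a cumulant of its advantage. -/
theorem softMaximum_eq {τ : ℝ} (hτ : 0 < τ) (v q : B → ℝ) :
    softMaximum τ q = softAverage τ v q
      + τ * Real.log (∑ b, softmaxProb v b * Real.exp (softAdvantage τ v q b / τ)) := by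
  set m := ∑ b, softmaxProb v b * (q b - τ * v b) with hm
  have hpos : 0 < ∑ b, softmaxProb v b * Real.exp (softAdvantage τ v q b / τ) :=
    Finset.sum_pos (fun b _ => mul_pos (softmaxProb_pos v b) (Real.exp_pos _))
      Finset.univ_nonempty
  have hexp : ∑ b, Real.exp (q b / τ) = Real.exp (m / τ) * (∑ b, Real.exp (v b)) *
      ∑ b, softmaxProb v b * Real.exp (softAdvantage τ v q b / τ) := by
    rw [Finset.mul_sum]
    refine Finset.sum_congr rfl fun b _ => ?_
    have h1 : q b / τ = m / τ + v b + softAdvantage τ v q b / τ := by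
      rw [softAdvantage, ← hm]; field_simp; ring
    rw [h1, Real.exp_add, Real.exp_add, softmaxProb]
    field_simp [(sum_exp_pos v).ne']
  rw [softMaximum, logSumExp, hexp, Real.log_mul (by have := sum_exp_pos v; positivity) hpos.ne',
    Real.log_mul (Real.exp_pos _).ne' (sum_exp_pos v).ne', Real.log_exp, softAverage, logSumExp,
    ← hm]
  field_simp

/-- Gibbs' variational inequality for softmax distributions. -/
theorem softAverage_le_softMaximum {τ : ℝ} (hτ : 0 < τ) (v q : B → ℝ) :
    softAverage τ v q ≤ softMaximum τ q := by
  rw [softMaximum_eq hτ v, le_add_iff_nonneg_right]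
  refine mul_nonneg hτ.le (Real.log_nonneg ?_)
  calc (1 : ℝ) = ∑ b, softmaxProb v b * (softAdvantage τ v q b / τ + 1) := by
        simp only [mul_add, Finset.sum_add_distrib, mul_one, (softmaxProb_mem_stdSimplex v).2,
          ← mul_div_assoc, ← Finset.sum_div, sum_softmaxProb_mul_softAdvantage, zero_div, zero_add]
    _ ≤ _ := Finset.sum_le_sum fun b _ => mul_le_mul_of_nonneg_left
        (Real.add_one_le_exp _) (softmaxProb_pos v b).le

theorem softMaximum_le_softAverage_add {τ : ℝ} (hτ : 0 < τ) (v q : B → ℝ) :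
    softMaximum τ q ≤ softAverage τ v q + (∑ b, softAdvantage τ v q b ^ 2) / (2 * τ) := by
  rw [softMaximum_eq hτ v, add_le_add_iff_left]
  set N := ∑ b, softAdvantage τ v q b ^ 2 with hN
  have hle : ∀ b, softAdvantage τ v q b ^ 2 ≤ N := fun b =>
    Finset.single_le_sum (f := fun b => softAdvantage τ v q b ^ 2)
      (fun b _ => sq_nonneg _) (Finset.mem_univ b)
  have hN0 : 0 ≤ N := Finset.sum_nonneg fun b _ => sq_nonneg _
  rcases hN0.eq_or_lt with h | h
  · have : ∀ b, softAdvantage τ v q b = 0 := fun b =>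
      pow_eq_zero_iff two_ne_zero |>.1 (le_antisymm (h ▸ hle b) (sq_nonneg _))
    simp [this, (softmaxProb_mem_stdSimplex v).2, ← h]
  · have hb := sum_mul_exp_le (softmaxProb_mem_stdSimplex v)
      (X := fun b => softAdvantage τ v q b / τ) (m := √N / τ) (by positivity)
      (fun b => by
        rw [abs_div, abs_of_pos hτ]
        exact div_le_div_of_nonneg_right (Real.abs_le_sqrt (hle b)) hτ.le)
      (by simp only [← mul_div_assoc, ← Finset.sum_div, sum_softmaxProb_mul_softAdvantage,
        zero_div])
    have hlog := Real.log_le_log (Finset.sum_pos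
      (fun b _ => mul_pos (softmaxProb_pos v b) (Real.exp_pos _)) Finset.univ_nonempty) hb
    rw [Real.log_exp, div_pow, Real.sq_sqrt h.le] at hlog
    calc _ ≤ τ * (N / τ ^ 2 / 2) := mul_le_mul_of_nonneg_left hlog hτ.le
      _ = _ := by field_simp

end Softmax

/-! ### Smoothness of the regularized operators -/

section Smoothness

variable {B E : Type*} [Fintype B] [Nonempty B] [NormedAddCommGroup E] [NormedSpace ℝ E]

theorem contDiff_logSumExp {w : E → B → ℝ} (hw : ∀ b, ContDiff ℝ 1 fun e => w e b) :
    ContDiff ℝ 1 fun e => logSumExp (w e) :=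
  ContDiff.log (ContDiff.sum fun b _ => (hw b).exp) fun _ => (sum_exp_pos _).ne'

theorem contDiff_softmaxProb {w : E → B → ℝ} (hw : ∀ b, ContDiff ℝ 1 fun e => w e b) (b : B) :
    ContDiff ℝ 1 fun e => softmaxProb (w e) b :=
  (hw b).exp.div (ContDiff.sum fun b _ => (hw b).exp) fun _ => (sum_exp_pos _).ne'

theorem contDiff_softAverage (τ : ℝ) {w q : E → B → ℝ} (hw : ∀ b, ContDiff ℝ 1 fun e => w e b)
    (hq : ∀ b, ContDiff ℝ 1 fun e => q e b) :
    ContDiff ℝ 1 fun e => softAverage τ (w e) (q e) :=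
  (ContDiff.sum fun b _ => (contDiff_softmaxProb hw b).mul
    ((hq b).sub (contDiff_const.mul (hw b)))).add (contDiff_const.mul (contDiff_logSumExp hw))

theorem contDiff_softMaximum (τ : ℝ) {q : E → B → ℝ} (hq : ∀ b, ContDiff ℝ 1 fun e => q e b) :
    ContDiff ℝ 1 fun e => softMaximum τ (q e) :=
  contDiff_const.mul (contDiff_logSumExp fun b => (hq b).div_const τ)

/-- The derivative of the regularized average along a curve of logits `w` and payoffs `q`. -/
theorem hasDerivAt_softAverage (τ : ℝ) {w q : ℝ → B → ℝ} {w' q' : B → ℝ} {t : ℝ}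
    (hw : ∀ b, HasDerivAt (fun t => w t b) (w' b) t)
    (hq : ∀ b, HasDerivAt (fun t => q t b) (q' b) t) :
    HasDerivAt (fun t => softAverage τ (w t) (q t))
      (∑ b, softmaxProb (w t) b * softAdvantage τ (w t) (q t) b * w' b
        + ∑ b, softmaxProb (w t) b * q' b) t := by
  have hZ : HasDerivAt (fun t => ∑ b, Real.exp (w t b)) (∑ b, Real.exp (w t b) * w' b) t :=
    HasDerivAt.fun_sum fun b _ => (hw b).exp
  have hZ0 := (sum_exp_pos (w t)).ne'
  have hσ : ∀ b, HasDerivAt (fun t => softmaxProb (w t) b)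
      (softmaxProb (w t) b * (w' b - ∑ b', softmaxProb (w t) b' * w' b')) t := fun b => by
    refine ((hw b).exp.div hZ hZ0).congr_deriv ?_
    simp only [softmaxProb, div_mul_eq_mul_div, ← Finset.sum_div]
    field_simp
  have hL : HasDerivAt (fun t => logSumExp (w t)) (∑ b, softmaxProb (w t) b * w' b) t := by
    refine (hZ.log hZ0).congr_deriv ?_
    simp only [softmaxProb, div_mul_eq_mul_div, ← Finset.sum_div]
  refine ((HasDerivAt.fun_sum fun b _ => (hσ b).mul ((hq b).fun_sub ((hw b).const_mul τ))).add
    (hL.const_mul τ)).congr_deriv ?_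
  simp only [softAdvantage]
  set m := ∑ b', softmaxProb (w t) b' * (q t b' - τ * w t b')
  set w₀ := ∑ b, softmaxProb (w t) b * w' b with hw₀
  have h1 : ∀ b, softmaxProb (w t) b * (w' b - w₀) * (q t b - τ * w t b)
        + softmaxProb (w t) b * (q' b - τ * w' b)
      = softmaxProb (w t) b * (q t b - τ * w t b - m) * w' b + m * (softmaxProb (w t) b * w' b)
        - w₀ * (softmaxProb (w t) b * (q t b - τ * w t b))
        + softmaxProb (w t) b * q' b - τ * (softmaxProb (w t) b * w' b) := fun b => by ring
  simp only [h1, Finset.sum_add_distrib, Finset.sum_sub_distrib, ← Finset.mul_sum, ← hw₀]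
  ring

end Smoothness

/-! ### Entropy-regularized Markov decision processes -/

section MarkovDecisionProcess

variable {S B E : Type*} [Fintype S] [NormedAddCommGroup E] [NormedSpace ℝ E]

theorem contDiff_actionValue {c : E → S → B → ℝ} {P : E → S → B → S → ℝ} {V : E → S → ℝ} (γ : ℝ)
    (hc : ∀ s b, ContDiff ℝ 1 fun e => c e s b) (hP : ∀ s b s', ContDiff ℝ 1 fun e => P e s b s')
    (hV : ∀ s, ContDiff ℝ 1 fun e => V e s) (s : S) (b : B) :
    ContDiff ℝ 1 fun e => actionValue (c e) (P e) γ (V e) s b :=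
  (hc s b).add (contDiff_const.mul (ContDiff.sum fun s' _ => (hP s b s').mul (hV s')))

variable [Fintype B] [Nonempty B]

/-- A parametrized entropy-regularized Markov decision process with smooth rewards and transition
probabilities has an optimal value, which depends differentiably on the parameter. -/
theorem exists_differentiable_optimalValue [CompleteSpace E] {c : E → S → B → ℝ}
    {P : E → S → B → S → ℝ} {γ τ : ℝ} (hγ : 0 ≤ γ) (hγ1 : γ < 1) (hτ : 0 < τ)
    (hc : ∀ s b, ContDiff ℝ 1 fun e => c e s b) (hP : ∀ s b s', ContDiff ℝ 1 fun e => P e s b s')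
    (hPs : ∀ e s b, P e s b ∈ stdSimplex ℝ S) :
    ∃ V : E → S → ℝ, Differentiable ℝ V ∧
      ∀ e s, softMaximum τ (actionValue (c e) (P e) γ (V e) s) = V e s := by
  lift γ to NNReal using hγ
  have hlip : ∀ e, LipschitzWith γ fun (V : S → ℝ) s =>
      softMaximum τ (actionValue (c e) (P e) γ V s) := fun e =>
    lipschitzWith_actionValue (fun _ => isSubtranslative_softMaximum hτ) (hPs e)
  have hcon : ∀ e, ContractingWith γ fun (V : S → ℝ) s =>
      softMaximum τ (actionValue (c e) (P e) γ V s) := fun e => ⟨by exact_mod_cast hγ1, hlip e⟩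
  refine ⟨fun e => (hcon e).fixedPoint, fun e => ?_,
    fun e s => congrFun (hcon e).fixedPoint_isFixedPt s⟩
  refine differentiableAt_of_fixedPoint_contraction
    (G := fun p : E × (S → ℝ) => fun s => softMaximum τ (actionValue (c p.1) (P p.1) γ p.2 s))
    (contDiff_pi.2 fun s => contDiff_softMaximum τ fun b => contDiff_actionValue γ
      (fun s b => (hc s b).comp contDiff_fst) (fun s b s' => (hP s b s').comp contDiff_fst)
      (fun s => (contDiff_apply ℝ ℝ s).comp contDiff_snd) s b)
    (K := γ) (by exact_mod_cast hγ1) hlip (fun e => (hcon e).fixedPoint_isFixedPt) e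

variable {c : S → B → ℝ} {P : S → B → S → ℝ} {γ τ : ℝ}

/-- The value of a softmax policy is a differentiable function of the logits. -/
theorem differentiable_softmaxValue (hγ : 0 ≤ γ) (hγ1 : γ < 1)
    (hP : ∀ s b, P s b ∈ stdSimplex ℝ S) {U : PolicyParam S B → S → ℝ}
    (hU : ∀ v s, U v s = softAverage τ (fun b => v (s, b)) (actionValue c P γ (U v) s)) :
    Differentiable ℝ U := fun v => by
  lift γ to NNReal using hγ
  have hw : ∀ s b, ContDiff ℝ 1 fun p : PolicyParam S B × (S → ℝ) => p.1 (s, b) := fun s b =>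
    (EuclideanSpace.proj (𝕜 := ℝ) (s, b)).contDiff.comp contDiff_fst
  have hq : ∀ s b, ContDiff ℝ 1 fun p : PolicyParam S B × (S → ℝ) => actionValue c P γ p.2 s b :=
    contDiff_actionValue (E := PolicyParam S B × (S → ℝ)) (c := fun _ => c) (P := fun _ => P)
      (V := fun p => p.2) γ (fun s b => contDiff_const) (fun s b s' => contDiff_const)
      (fun s => (contDiff_apply ℝ ℝ s).comp contDiff_snd)
  let G : PolicyParam S B × (S → ℝ) → S → ℝ := fun p s =>
    softAverage τ (fun b => p.1 (s, b)) (actionValue c P γ p.2 s)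
  have hG : ContDiff ℝ 1 G := contDiff_pi.2 fun s => contDiff_softAverage τ (hw s) (hq s)
  have hlip : ∀ v, LipschitzWith γ fun V => G (v, V) := fun v =>
    lipschitzWith_actionValue (f := fun s => softAverage τ fun b => v (s, b))
      (fun _ => isSubtranslative_softAverage τ _) hP
  have hfix : ∀ v, G (v, U v) = U v := fun v => funext fun s => (hU v s).symm
  have hK : γ < 1 := by exact_mod_cast hγ1
  exact differentiableAt_of_fixedPoint_contraction hG hK hlip hfix v

/-- Each partial derivative of the value controls the corresponding advantage (the policy gradient
theorem gives the derivative as visitation weight times probability times advantage, and the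
visitation weight of a state is at least its initial probability). -/
theorem mul_abs_softAdvantage_le (hγ : 0 ≤ γ) (hγ1 : γ < 1)
    (hP : ∀ s b, P s b ∈ stdSimplex ℝ S) {U : PolicyParam S B → S → ℝ}
    (hU : ∀ v s, U v s = softAverage τ (fun b => v (s, b)) (actionValue c P γ (U v) s))
    {ρ : S → ℝ} (hρ : ∀ s, 0 ≤ ρ s) (v : PolicyParam S B) (s₀ : S) (b₀ : B) :
    ρ s₀ * (softmaxProb (fun b => v (s₀, b)) b₀ *
        |softAdvantage τ (fun b => v (s₀, b)) (actionValue c P γ (U v) s₀) b₀|)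
      ≤ |gradient (fun v => ∑ s, ρ s * U v s) v (s₀, b₀)| := by
  classical
  have hdiff := differentiable_softmaxValue hγ hγ1 hP hU
  have hdiffs : ∀ s, DifferentiableAt ℝ (fun v => U v s) v := fun s =>
    differentiableAt_pi.1 (hdiff v) s
  have hJ : DifferentiableAt ℝ (fun v => ∑ s, ρ s * U v s) v := by fun_prop
  set e : PolicyParam S B := EuclideanSpace.single (s₀, b₀) 1 with he
  set D : S → ℝ := fun s => fderiv ℝ (fun v => U v s) v e with hD
  have hline : HasDerivAt (fun t : ℝ => v + t • e) e 0 := by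
    simpa using ((hasDerivAt_id (0 : ℝ)).smul_const e).const_add v
  have hUD : ∀ s, HasDerivAt (fun t : ℝ => U (v + t • e) s) (D s) 0 := fun s =>
    HasFDerivAt.comp_hasDerivAt_of_eq (f := fun t : ℝ => v + t • e) 0 (hdiffs s).hasFDerivAt hline
      (by simp)
  have hgrad : gradient (fun v => ∑ s, ρ s * U v s) v (s₀, b₀) = ∑ s, ρ s * D s := by
    have h1 : gradient (fun v => ∑ s, ρ s * U v s) v (s₀, b₀)
        = fderiv ℝ (fun v => ∑ s, ρ s * U v s) v e := by
      rw [← toDual_gradient, InnerProductSpace.toDual_apply_apply, he,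
        EuclideanSpace.inner_single_right]
      simp
    rw [h1]
    refine HasDerivAt.unique (HasFDerivAt.comp_hasDerivAt_of_eq (f := fun t : ℝ => v + t • e) 0
      hJ.hasFDerivAt hline (by simp)) (HasDerivAt.fun_sum fun s _ => (hUD s).const_mul (ρ s))
  have hDeq : ∀ s, D s = (if s = s₀ then softmaxProb (fun b => v (s₀, b)) b₀ *
        softAdvantage τ (fun b => v (s₀, b)) (actionValue c P γ (U v) s₀) b₀ else 0)
      + γ * ∑ b, softmaxProb (fun b => v (s, b)) b * ∑ s', P s b s' * D s' := fun s => by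
    have hR := hasDerivAt_softAverage τ (t := 0)
      (w := fun t b => (v + t • e) (s, b)) (w' := fun b => if (s, b) = (s₀, b₀) then 1 else 0)
      (q := fun t => actionValue c P γ (U (v + t • e)) s) (q' := fun b => γ * ∑ s', P s b s' * D s')
      (fun b => by
        have := ((hasDerivAt_id (0 : ℝ)).mul_const (e (s, b))).const_add (v (s, b))
        refine this.congr_deriv ?_
        simp [he])
      (fun b => ((HasDerivAt.fun_sum fun s' _ => (hUD s').const_mul (P s b s')).const_mul
        γ).const_add (c s b))
    rw [((hUD s).congr_of_eventuallyEq
      (Filter.Eventually.of_forall fun t => (hU _ s).symm)).unique hR]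
    simp only [zero_smul, add_zero]
    congr 1
    · split_ifs with h
      · subst h
        simp
      · simp [h]
    · simp only [Finset.mul_sum]
      simp only [mul_left_comm]
  rw [hgrad, ← abs_of_pos (softmaxProb_pos (fun b => v (s₀, b)) b₀), ← abs_mul]
  exact abs_le_abs_sum_of_source hP hγ hγ1 (fun s => softmaxProb_mem_stdSimplex _) hDeq hρ

theorem softmaxValue_le_optimalValue (hγ : 0 ≤ γ) (hγ1 : γ < 1) (hτ : 0 < τ)
    (hP : ∀ s b, P s b ∈ stdSimplex ℝ S) {U V : S → ℝ} {v : S → B → ℝ}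
    (hU : ∀ s, U s = softAverage τ (v s) (actionValue c P γ U s))
    (hV : ∀ s, softMaximum τ (actionValue c P γ V s) = V s) (s : S) : U s ≤ V s := by
  simpa using le_add_of_le_actionValue (fun _ => isSubtranslative_softMaximum hτ) hP hγ hγ1
    (ε := 0) (fun s => (hU s).le.trans (softAverage_le_softMaximum hτ _ _))
    (fun s => by rw [hV, add_zero]) s

/-- The policy with logits `q* / τ`, where `q*` are the optimal action values, is optimal. -/
theorem softmaxValue_eq_optimalValue (hγ : 0 ≤ γ) (hγ1 : γ < 1) (hτ : 0 < τ)
    (hP : ∀ s b, P s b ∈ stdSimplex ℝ S) {U V : S → ℝ}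
    (hU : ∀ s, U s = softAverage τ (fun b => actionValue c P γ V s b / τ) (actionValue c P γ U s))
    (hV : ∀ s, softMaximum τ (actionValue c P γ V s) = V s) (s : S) : U s = V s := by
  refine le_antisymm (softmaxValue_le_optimalValue hγ hγ1 hτ hP hU hV s) ?_
  simpa using le_add_of_le_actionValue (W := U) (ε := 0)
    (f := fun s => softAverage τ (fun b => actionValue c P γ V s b / τ))
    (fun _ => isSubtranslative_softAverage τ _) hP hγ hγ1
    (fun s => by rw [softAverage_div_eq_softMaximum hτ, hV])
    (fun s => by rw [← hU, add_zero]) s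

/-- The Polyak–Łojasiewicz inequality for the value of a softmax policy. -/
theorem mul_optimalValue_sub_le_norm_gradient_sq (hγ : 0 ≤ γ) (hγ1 : γ < 1) (hτ : 0 < τ)
    (hP : ∀ s b, P s b ∈ stdSimplex ℝ S) {U : PolicyParam S B → S → ℝ} {V : S → ℝ}
    (hU : ∀ v s, U v s = softAverage τ (fun b => v (s, b)) (actionValue c P γ (U v) s))
    (hV : ∀ s, softMaximum τ (actionValue c P γ V s) = V s)
    {ρ : S → ℝ} (hρ : ρ ∈ stdSimplex ℝ S) (v : PolicyParam S B) {κ κ' : ℝ} (hκ : 0 < κ)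
    (hκ' : 0 < κ') (hκρ : ∀ s, κ ≤ ρ s ^ 2)
    (hκv : ∀ s b, κ' ≤ softmaxProb (fun b => v (s, b)) b ^ 2) :
    (1 - γ) * τ * κ * κ' * (∑ s, ρ s * V s - ∑ s, ρ s * U v s)
      ≤ 1 / 2 * ‖gradient (fun v => ∑ s, ρ s * U v s) v‖ ^ 2 := by
  set g := gradient (fun v => ∑ s, ρ s * U v s) v with hg
  set adv : S → B → ℝ := fun s =>
    softAdvantage τ (fun b => v (s, b)) (actionValue c P γ (U v) s) with hadv
  have hsq : ∀ s b, κ * κ' * adv s b ^ 2 ≤ g (s, b) ^ 2 := fun s b => by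
    have h1 := mul_abs_softAdvantage_le hγ hγ1 hP hU hρ.1 v s b
    have h2 := pow_le_pow_left₀ (mul_nonneg (hρ.1 s)
      (mul_nonneg (softmaxProb_pos _ _).le (abs_nonneg _))) h1 2
    rw [mul_pow, mul_pow, sq_abs, sq_abs, ← mul_assoc] at h2
    refine le_trans ?_ h2
    exact mul_le_mul_of_nonneg_right
      (mul_le_mul (hκρ s) (hκv s b) hκ'.le (sq_nonneg _)) (sq_nonneg _)
  have hsum : ∀ s, ∑ b, adv s b ^ 2 ≤ ‖g‖ ^ 2 / (κ * κ') := fun s => by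
    rw [le_div_iff₀ (by positivity), mul_comm, EuclideanSpace.norm_sq_eq, Fintype.sum_prod_type,
      Finset.mul_sum]
    calc ∑ b, κ * κ' * adv s b ^ 2 ≤ ∑ b, ‖g (s, b)‖ ^ 2 :=
          Finset.sum_le_sum fun b _ => by simpa using hsq s b
      _ ≤ _ := Finset.single_le_sum (f := fun s => ∑ b, ‖g (s, b)‖ ^ 2)
          (fun s _ => Finset.sum_nonneg fun b _ => sq_nonneg _) (Finset.mem_univ s)
  set ε := ‖g‖ ^ 2 / (κ * κ') / (2 * τ) with hε
  have hgap : ∀ s, V s ≤ U v s + ε / (1 - γ) :=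
    le_add_of_le_actionValue (fun _ => isSubtranslative_softMaximum hτ) hP hγ hγ1
      (fun s => (hV s).ge) fun s => by
        refine (softMaximum_le_softAverage_add hτ (fun b => v (s, b)) _).trans ?_
        rw [← hU v s]
        exact add_le_add le_rfl (div_le_div_of_nonneg_right (hsum s) (by positivity))
  have htot : ∑ s, ρ s * V s - ∑ s, ρ s * U v s ≤ ε / (1 - γ) := by
    rw [sub_le_iff_le_add']
    calc ∑ s, ρ s * V s ≤ ∑ s, ρ s * (U v s + ε / (1 - γ)) :=
          Finset.sum_le_sum fun s _ => mul_le_mul_of_nonneg_left (hgap s) (hρ.1 s)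
      _ = _ := by simp only [mul_add, Finset.sum_add_distrib, ← Finset.sum_mul, hρ.2, one_mul]
  have h1γ : 0 < 1 - γ := by linarith
  calc _ ≤ (1 - γ) * τ * κ * κ' * (ε / (1 - γ)) := by gcongr
    _ = _ := by rw [hε]; field_simp

end MarkovDecisionProcess


/-! ### Best responses in an entropy-regularized Markov game -/

section BestResponse

theorem toReal_softmax {A : Type*} [Fintype A] [Nonempty A] (v : A → ℝ) (a : A) :
    (softmax v a).toReal = softmaxProb v a := by
  rw [softmax, PMF.ofFintype_apply, ← softmaxProb,
    ENNReal.toReal_ofReal (softmaxProb_pos v a).le]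

theorem shannonEntropy_softmax {A : Type*} [Fintype A] [Nonempty A] (v : A → ℝ) :
    shannonEntropy (softmax v) = logSumExp v - ∑ a, softmaxProb v a * v a := by
  have : ∀ a, Real.negMulLog (softmaxProb v a)
      = softmaxProb v a * logSumExp v - softmaxProb v a * v a := fun a => by
    rw [Real.negMulLog, log_softmaxProb]; ring
  simp only [shannonEntropy, toReal_softmax, this, Finset.sum_sub_distrib, ← Finset.sum_mul,
    (softmaxProb_mem_stdSimplex v).2, one_mul]

theorem PMF.toReal_mem_stdSimplex {S : Type*} [Fintype S] (p : PMF S) :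
    (fun s => (p s).toReal) ∈ stdSimplex ℝ S :=
  ⟨fun _ => ENNReal.toReal_nonneg, by
    rw [← ENNReal.toReal_sum fun s _ => p.apply_ne_top s, ← tsum_fintype (L := .unconditional S), p.tsum_coe,
      ENNReal.toReal_one]⟩

theorem contDiff_shannonEntropy_softmax {E A : Type*} [NormedAddCommGroup E] [NormedSpace ℝ E]
    [Fintype A] [Nonempty A] {w : E → A → ℝ} (hw : ∀ a, ContDiff ℝ 1 fun e => w e a) :
    ContDiff ℝ 1 fun e => shannonEntropy (softmax (w e)) := by
  simp only [shannonEntropy_softmax]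
  exact (contDiff_logSumExp hw).sub
    (ContDiff.sum fun a _ => (contDiff_softmaxProb hw a).mul (hw a))

variable {S A B : Type*} [Fintype S] [Fintype A] [Fintype B] [Nonempty B]

/-- Averaging the opponent's action out of a Bellman equation leaves the Bellman equation of a
single-agent regularized decision process. -/
theorem sum_sum_eq_softAverage {p : S → A → ℝ} (hp : ∀ s, p s ∈ stdSimplex ℝ A) (v : S → B → ℝ)
    (r : S → A → B → ℝ) (h : S → ℝ) (τ γ : ℝ) (P : S → A → B → S → ℝ) (U : S → ℝ) (s : S) :
    ∑ a, ∑ b, p s a * softmaxProb (v s) b *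
        (r s a b + (h s + τ * shannonEntropy (softmax (v s))) + γ * ∑ s', P s a b s' * U s')
      = softAverage τ (v s) (actionValue (fun s b => ∑ a, p s a * r s a b + h s)
          (fun s b s' => ∑ a, p s a * P s a b s') γ U s) := by
  have h1 : ∀ b, ∑ a, p s a * softmaxProb (v s) b *
        (r s a b + (h s + τ * shannonEntropy (softmax (v s))) + γ * ∑ s', P s a b s' * U s')
      = softmaxProb (v s) b * (actionValue (fun s b => ∑ a, p s a * r s a b + h s)
          (fun s b s' => ∑ a, p s a * P s a b s') γ U s b)
        + softmaxProb (v s) b * (τ * shannonEntropy (softmax (v s))) := fun b => by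
    have h2 : ∑ s', (∑ a, p s a * P s a b s') * U s'
        = ∑ a, p s a * ∑ s', P s a b s' * U s' := by
      simp only [Finset.sum_mul, Finset.mul_sum, mul_assoc]
      exact Finset.sum_comm
    have h3 : ∀ a, p s a * softmaxProb (v s) b *
          (r s a b + (h s + τ * shannonEntropy (softmax (v s))) + γ * ∑ s', P s a b s' * U s')
        = softmaxProb (v s) b * (p s a * r s a b)
          + softmaxProb (v s) b * (γ * (p s a * ∑ s', P s a b s' * U s'))
          + p s a * (softmaxProb (v s) b * (h s + τ * shannonEntropy (softmax (v s)))) :=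
      fun a => by ring
    rw [actionValue, h2, Finset.sum_congr rfl fun a _ => h3 a, Finset.sum_add_distrib,
      Finset.sum_add_distrib, ← Finset.sum_mul, (hp s).2, ← Finset.mul_sum, ← Finset.mul_sum,
      ← Finset.mul_sum]
    ring
  rw [Finset.sum_comm, Finset.sum_congr rfl fun b _ => h1 b, Finset.sum_add_distrib,
    ← Finset.sum_mul, (softmaxProb_mem_stdSimplex (v s)).2, one_mul, shannonEntropy_softmax,
    softAverage]
  simp only [mul_sub, Finset.sum_sub_distrib, Finset.mul_sum, mul_left_comm τ]
  ring

variable [Nonempty A]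

/-- The best-response value `F φ` of the maximizing player against the logits `φ` of the opponent:
it is attained and differentiable in `φ`, and the payoff satisfies a Polyak–Łojasiewicz inequality
in the logits of the maximizing player. -/
theorem exists_bestResponseValue {γ τ τ' : ℝ} (hγ : 0 ≤ γ) (hγ1 : γ < 1) (hτ : 0 < τ)
    (r : S → A → B → ℝ) {P : S → A → B → S → ℝ} (hP : ∀ s a b, P s a b ∈ stdSimplex ℝ S)
    {ρ : S → ℝ} (hρ : ρ ∈ stdSimplex ℝ S) {U : PolicyParam S A → PolicyParam S B → S → ℝ}
    (hU : ∀ φ ψ s, U φ ψ s = ∑ a, ∑ b,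
      softmaxProb (fun a => φ (s, a)) a * softmaxProb (fun b => ψ (s, b)) b *
        (r s a b + (-τ' * shannonEntropy (softmaxPolicy φ s) + τ * shannonEntropy (softmaxPolicy ψ s))
          + γ * ∑ s', P s a b s' * U φ ψ s')) :
    ∃ F : PolicyParam S A → ℝ, Differentiable ℝ F ∧ (∀ φ ψ, ∑ s, ρ s * U φ ψ s ≤ F φ) ∧
      (∀ φ, ∃ ψ, ∑ s, ρ s * U φ ψ s = F φ) ∧
      (∀ φ, Differentiable ℝ fun ψ => ∑ s, ρ s * U φ ψ s) ∧
      ∀ φ ψ (κ κ' : ℝ), 0 < κ → 0 < κ' → (∀ s, κ ≤ ρ s ^ 2) →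
        (∀ s b, κ' ≤ softmaxProb (fun b => ψ (s, b)) b ^ 2) →
        (1 - γ) * τ * κ * κ' * (F φ - ∑ s, ρ s * U φ ψ s)
          ≤ 1 / 2 * ‖gradient (fun ψ => ∑ s, ρ s * U φ ψ s) ψ‖ ^ 2 := by
  set c : PolicyParam S A → S → B → ℝ := fun φ s b =>
    ∑ a, softmaxProb (fun a => φ (s, a)) a * r s a b
      + -τ' * shannonEntropy (softmax fun a => φ (s, a)) with hc
  set Q : PolicyParam S A → S → B → S → ℝ := fun φ s b s' =>
    ∑ a, softmaxProb (fun a => φ (s, a)) a * P s a b s' with hQ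
  have hQs : ∀ φ s b, Q φ s b ∈ stdSimplex ℝ S := fun φ s b => by
    have hp := softmaxProb_mem_stdSimplex fun a => φ (s, a)
    refine ⟨fun s' => Finset.sum_nonneg fun a _ => mul_nonneg (hp.1 a) ((hP s a b).1 s'), ?_⟩
    rw [hQ, Finset.sum_comm]
    simp only [← Finset.mul_sum, (hP _ _ _).2, mul_one, hp.2]
  have hlogit : ∀ (s : S) (a : A), ContDiff ℝ 1 fun φ : PolicyParam S A => φ (s, a) :=
    fun s a => (EuclideanSpace.proj (𝕜 := ℝ) (s, a)).contDiff
  have hcd : ∀ s b, ContDiff ℝ 1 fun φ => c φ s b := fun s b =>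
    (ContDiff.sum fun a _ => (contDiff_softmaxProb (hlogit s) a).mul contDiff_const).add
      (contDiff_const.mul (contDiff_shannonEntropy_softmax (hlogit s)))
  have hQd : ∀ s b s', ContDiff ℝ 1 fun φ => Q φ s b s' := fun s b s' =>
    ContDiff.sum fun a _ => (contDiff_softmaxProb (hlogit s) a).mul contDiff_const
  have hU' : ∀ φ ψ s, U φ ψ s = softAverage τ (fun b => ψ (s, b))
      (actionValue (c φ) (Q φ) γ (U φ ψ) s) := fun φ ψ s => by
    refine (hU φ ψ s).trans (sum_sum_eq_softAverage
      (p := fun s => softmaxProb fun a => φ (s, a)) (fun s => softmaxProb_mem_stdSimplex _)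
      (fun s b => ψ (s, b)) r (fun s => -τ' * shannonEntropy (softmax fun a => φ (s, a)))
      τ γ P (U φ ψ) s)
  obtain ⟨V, hVd, hV⟩ := exists_differentiable_optimalValue hγ hγ1 hτ hcd hQd hQs
  refine ⟨fun φ => ∑ s, ρ s * V φ s, fun φ => ?_, fun φ ψ => ?_, fun φ => ?_, fun φ ψ => ?_,
    fun φ ψ κ κ' hκ hκ' hκρ hκψ => ?_⟩
  · have := fun s => differentiableAt_pi.1 (hVd φ) s
    fun_prop
  · exact Finset.sum_le_sum fun s _ => mul_le_mul_of_nonneg_left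
      (softmaxValue_le_optimalValue hγ hγ1 hτ (hQs φ) (hU' φ ψ) (hV φ) s) (hρ.1 s)
  · set ψ : PolicyParam S B :=
      WithLp.toLp 2 fun z => actionValue (c φ) (Q φ) γ (V φ) z.1 z.2 / τ
    exact ⟨ψ, Finset.sum_congr rfl fun s _ => by
      rw [softmaxValue_eq_optimalValue hγ hγ1 hτ (hQs φ) (hU' φ ψ) (hV φ) s]⟩
  · have := fun s => differentiableAt_pi.1 (differentiable_softmaxValue hγ hγ1 (hQs φ) (hU' φ) ψ) s
    fun_prop
  · exact mul_optimalValue_sub_le_norm_gradient_sq hγ hγ1 hτ (hQs φ) (hU' φ) (hV φ) hρ ψ hκ hκ'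
      hκρ hκψ

end BestResponse

/-! ### Gradients -/

section Gradient

variable {E F : Type*} [NormedAddCommGroup E] [InnerProductSpace ℝ E] [CompleteSpace E]
  [NormedAddCommGroup F] [InnerProductSpace ℝ F] [CompleteSpace F]

/-- The envelope principle: if `-g` touches `f` from below at `x`, the gradients of `f` and `-g`
agree there. -/
theorem norm_gradient_eq_of_add_nonneg {f g : E → ℝ} {x : E} (hf : DifferentiableAt ℝ f x)
    (hg : DifferentiableAt ℝ g x) (h : ∀ y, 0 ≤ f y + g y) (hx : f x + g x = 0) :
    ‖gradient f x‖ = ‖gradient g x‖ := by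
  have hmin : IsLocalMin (fun y => f y + g y) x :=
    Filter.Eventually.of_forall fun y => by simpa only [hx] using h y
  have h0 := hmin.hasFDerivAt_eq_zero (hf.hasFDerivAt.add hg.hasFDerivAt)
  rw [gradient, gradient, eq_neg_of_add_eq_zero_left h0, map_neg, norm_neg]

theorem hasGradientAt_add_prod {f : E → ℝ} {g : F → ℝ} {x : E} {y : F}
    (hf : DifferentiableAt ℝ f x) (hg : DifferentiableAt ℝ g y) :
    HasGradientAt (fun z : WithLp 2 (E × F) => f z.fst + g z.snd)
      (WithLp.toLp 2 (gradient f x, gradient g y)) (WithLp.toLp 2 (x, y)) := by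
  rw [hasGradientAt_iff_hasFDerivAt]
  refine ((hf.hasFDerivAt.comp (WithLp.toLp 2 (x, y))
    (WithLp.fstL 2 ℝ E F).hasFDerivAt).add
    (hg.hasFDerivAt.comp (WithLp.toLp 2 (x, y)) (WithLp.sndL 2 ℝ E F).hasFDerivAt)).congr_fderiv ?_
  ext z
  change fderiv ℝ f x z.fst + fderiv ℝ g y z.snd = inner ℝ (WithLp.toLp 2 (_, _)) z
  rw [WithLp.prod_inner_apply, ← toDual_gradient, ← toDual_gradient,
    InnerProductSpace.toDual_apply_apply, InnerProductSpace.toDual_apply_apply]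
  rfl

end Gradient

/-! ### The Nikaido–Isoda gap -/

namespace EntropyMarkovGame

variable {X S A B : Type*}
    [Fintype S] [MeasurableSpace S] [MeasurableSingletonClass S]
    [Fintype A] [MeasurableSpace A] [MeasurableSingletonClass A] [Nonempty A]
    [Fintype B] [MeasurableSpace B] [MeasurableSingletonClass B] [Nonempty B]

theorem stateValue_softmaxPolicy_eq (M : EntropyMarkovGame X S A B) (x : X) (φ : PolicyParam S A)
    (ψ : PolicyParam S B) (s : S) :
    M.stateValue x (softmaxPolicy φ) (softmaxPolicy ψ) s = ∑ a, ∑ b,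
      softmaxProb (fun a => φ (s, a)) a * softmaxProb (fun b => ψ (s, b)) b *
        (M.reward x s a b + (-M.τφ * shannonEntropy (softmaxPolicy φ s)
            + M.τψ * shannonEntropy (softmaxPolicy ψ s))
          + M.γ * ∑ s', (M.trans s a b s').toReal *
            M.stateValue x (softmaxPolicy φ) (softmaxPolicy ψ) s') := by
  rw [stateValue_eq]
  simp only [actionAverage, stagePayoff, regularizer, softmaxPolicy, toReal_softmax]

end EntropyMarkovGame
end

theorem lemma1 {X S A B : Type*}
    [Fintype S] [MeasurableSpace S] [MeasurableSingletonClass S]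
    [Fintype A] [MeasurableSpace A] [MeasurableSingletonClass A] [Nonempty A]
    [Fintype B] [MeasurableSpace B] [MeasurableSingletonClass B] [Nonempty B]
    (M : EntropyMarkovGame X S A B) (x : X) (φ : PolicyParam S A) (ψ : PolicyParam S B) :
    -- the maximum and the minimum in the definition of the gap are attained
    (∃ ψstar, ∀ ψ', M.J x φ ψ' ≤ M.J x φ ψstar) ∧
    (∃ φstar, ∀ φ', M.J x φstar ψ ≤ M.J x φ' ψ) ∧
    -- the gap is differentiable in `(φ, ψ)`
    DifferentiableAt ℝ (M.niGapJoint x) (WithLp.toLp 2 (φ, ψ)) ∧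
    0 < M.plConstant φ ψ ∧
    (1 / 2) * ‖gradient (M.niGapJoint x) (WithLp.toLp 2 (φ, ψ))‖ ^ 2
      ≥ M.plConstant φ ψ * M.niGap x φ ψ := by
  have hS : Nonempty S := M.init.support_nonempty.to_type
  have hρ := PMF.toReal_mem_stdSimplex M.init
  have hγ := M.γ_pos.le
  -- `F` is the best-response value of the max-player, `F'` that of the min-player, whose payoff
  -- is `-J`
  obtain ⟨F, hFd, hF, hFa, hFJ, hFP⟩ := exists_bestResponseValue hγ M.γ_lt_one M.τψ_pos
    (M.reward x) (fun s a b => PMF.toReal_mem_stdSimplex (M.trans s a b)) hρ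
    (M.stateValue_softmaxPolicy_eq x)
  obtain ⟨F', hFd', hF', hFa', hFJ', hFP'⟩ := exists_bestResponseValue hγ M.γ_lt_one M.τφ_pos
    (τ' := M.τψ) (fun s b a => -M.reward x s a b)
    (fun s b a => PMF.toReal_mem_stdSimplex (M.trans s a b)) hρ
    (U := fun ψ φ s => -M.stateValue x (softmaxPolicy φ) (softmaxPolicy ψ) s) (fun ψ φ s => by
      rw [M.stateValue_softmaxPolicy_eq x φ ψ s, Finset.sum_comm]
      simp only [mul_neg, ← Finset.sum_neg_distrib]
      refine Finset.sum_congr rfl fun b _ => Finset.sum_congr rfl fun a _ => ?_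
      simp only [Finset.sum_neg_distrib]
      ring)
  have hneg : ∀ φ ψ, ∑ s, (M.init s).toReal *
      -M.stateValue x (softmaxPolicy φ) (softmaxPolicy ψ) s = -M.J x φ ψ := fun φ ψ => by
    simp only [mul_neg, Finset.sum_neg_distrib]; rfl
  have hJ : ∀ φ ψ, ∑ s, (M.init s).toReal *
      M.stateValue x (softmaxPolicy φ) (softmaxPolicy ψ) s = M.J x φ ψ := fun _ _ => rfl
  simp only [hneg] at hF' hFa' hFJ' hFP'
  simp only [hJ] at hF hFa hFJ hFP
  have hgap : ∀ φ ψ, M.niGap x φ ψ = F φ + F' ψ := fun φ ψ => by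
    obtain ⟨ψ', hψ'⟩ := hFa φ
    obtain ⟨φ', hφ'⟩ := hFa' ψ
    have h1 : ⨆ ψ', M.J x φ ψ' = F φ :=
      IsGreatest.csSup_eq ⟨⟨ψ', hψ'⟩, by rintro _ ⟨y, rfl⟩; exact hF φ y⟩
    have h2 : ⨅ φ', M.J x φ' ψ = -F' ψ :=
      IsLeast.csInf_eq ⟨⟨φ', by linarith⟩, by rintro _ ⟨y, rfl⟩; linarith [hF' ψ y]⟩
    rw [EntropyMarkovGame.niGap, h1, h2, sub_neg_eq_add]
  have hgrad : HasGradientAt (M.niGapJoint x)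
      (WithLp.toLp 2 (gradient F φ, gradient F' ψ)) (WithLp.toLp 2 (φ, ψ)) := by
    have : M.niGapJoint x = fun θ => F θ.fst + F' θ.snd := funext fun θ => hgap _ _
    rw [this]
    exact hasGradientAt_add_prod (hFd φ) (hFd' ψ)
  obtain ⟨ψ₁, hψ₁⟩ := hFa φ
  obtain ⟨φ₁, hφ₁⟩ := hFa' ψ
  set κ := ⨅ s, (M.init s).toReal ^ 2 with hκ
  set κ' := min (⨅ p : S × A, (softmaxPolicy φ p.1 p.2).toReal ^ 2)
    (⨅ p : S × B, (softmaxPolicy ψ p.1 p.2).toReal ^ 2) with hκ'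
  have hκpos : 0 < κ := by
    obtain ⟨s, hs⟩ := exists_eq_ciInf_of_finite (f := fun s => (M.init s).toReal ^ 2)
    rw [hκ, ← hs]
    exact pow_pos (ENNReal.toReal_pos (M.init_pos s).ne' (M.init.apply_ne_top s)) 2
  have hκpos' : 0 < κ' := by
    obtain ⟨p, hp⟩ := exists_eq_ciInf_of_finite
      (f := fun p : S × A => (softmaxPolicy φ p.1 p.2).toReal ^ 2)
    obtain ⟨q, hq⟩ := exists_eq_ciInf_of_finite
      (f := fun p : S × B => (softmaxPolicy ψ p.1 p.2).toReal ^ 2)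
    rw [hκ', ← hp, ← hq]
    simp only [softmaxPolicy, toReal_softmax]
    exact lt_min (pow_pos (softmaxProb_pos _ _) 2) (pow_pos (softmaxProb_pos _ _) 2)
  have hκρ : ∀ s, κ ≤ (M.init s).toReal ^ 2 := fun s => ciInf_le (Set.finite_range _).bddBelow s
  have hκφ : ∀ s a, κ' ≤ softmaxProb (fun a => φ (s, a)) a ^ 2 := fun s a => by
    rw [← toReal_softmax]
    exact (min_le_left _ _).trans (ciInf_le (Set.finite_range _).bddBelow (s, a))
  have hκψ : ∀ s b, κ' ≤ softmaxProb (fun b => ψ (s, b)) b ^ 2 := fun s b => by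
    rw [← toReal_softmax]
    exact (min_le_right _ _).trans (ciInf_le (Set.finite_range _).bddBelow (s, b))
  have hγ' : 0 < 1 - M.γ := by linarith [M.γ_lt_one]
  have hcard : (1 : ℝ) ≤ Fintype.card S := by exact_mod_cast Fintype.card_pos
  have hτ : 0 < min M.τφ M.τψ := lt_min M.τφ_pos M.τψ_pos
  have hpos : 0 < M.plConstant φ ψ :=
    mul_pos (mul_pos (mul_pos hγ' (div_pos hτ (by linarith))) hκpos) hκpos'
  have hle : ∀ τ, min M.τφ M.τψ ≤ τ → M.plConstant φ ψ ≤ (1 - M.γ) * τ * κ * κ' := fun τ h =>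
    mul_le_mul_of_nonneg_right (mul_le_mul_of_nonneg_right (mul_le_mul_of_nonneg_left
      ((div_le_self hτ.le hcard).trans h) hγ'.le) hκpos.le) hκpos'.le
  refine ⟨⟨ψ₁, fun ψ' => (hF φ ψ').trans hψ₁.ge⟩, ⟨φ₁, fun φ' => by linarith [hF' ψ φ']⟩,
    hgrad.differentiableAt, hpos, ?_⟩
  -- the envelope principle, at the best responses `ψ₁` to `φ` and `φ₁` to `ψ`
  have hn : ‖gradient F φ‖ = ‖gradient (fun φ => -M.J x φ ψ₁) φ‖ :=
    norm_gradient_eq_of_add_nonneg (hFd φ) (hFJ' ψ₁ φ) (fun y => by linarith [hF y ψ₁])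
      (by linarith)
  have hn' : ‖gradient F' ψ‖ = ‖gradient (fun ψ => M.J x φ₁ ψ) ψ‖ :=
    norm_gradient_eq_of_add_nonneg (hFd' ψ) (hFJ φ₁ ψ) (fun y => by linarith [hF' y φ₁])
      (by linarith)
  have h1 := hFP' ψ₁ φ κ κ' hκpos hκpos' hκρ hκφ
  have h2 := hFP φ₁ ψ κ κ' hκpos hκpos' hκρ hκψ
  rw [← hn] at h1
  rw [← hn'] at h2
  have h3 := mul_le_mul_of_nonneg_right (hle M.τφ (min_le_left _ _))
    (show 0 ≤ F' ψ₁ - -M.J x φ ψ₁ by linarith [hF' ψ₁ φ])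
  have h4 := mul_le_mul_of_nonneg_right (hle M.τψ (min_le_right _ _))
    (show 0 ≤ F φ₁ - M.J x φ₁ ψ by linarith [hF φ₁ ψ])
  -- weak duality: the gap at `(φ₁, ψ₁)` is nonnegative
  have h5 : 0 ≤ M.plConstant φ ψ * (F φ₁ + F' ψ₁) :=
    mul_nonneg hpos.le (by linarith [hF φ₁ ψ₁, hF' ψ₁ φ₁])
  rw [hgrad.gradient, WithLp.prod_norm_sq_eq_of_L2, hgap, ge_iff_le]
  calc M.plConstant φ ψ * (F φ + F' ψ)
      ≤ M.plConstant φ ψ * (F φ + F' ψ) + M.plConstant φ ψ * (F φ₁ + F' ψ₁) := by linarith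
    _ = M.plConstant φ ψ * (F' ψ₁ - -M.J x φ ψ₁) + M.plConstant φ ψ * (F φ₁ - M.J x φ₁ ψ) := by
        rw [hψ₁, show M.J x φ₁ ψ = -F' ψ by linarith]; ring
    _ ≤ _ := by
        change _ ≤ 1 / 2 * (‖gradient F φ‖ ^ 2 + ‖gradient F' ψ‖ ^ 2)
        linarith
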